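/- Setup. Let $a\ge 1$ and let $\phi,\psi\in L^2(\mathbb R)$ satisfy $\operatorname{supp}\phi=\operatorname{supp}\psi=[0,a]$ (essential supports). Suppose that $\phi$ is the scaling function of a multiresolution analysis $(V_j)_{j\in\mathbb Z}$ of $L^2(\mathbb R)$: the $V_j$ are closed subspaces with $V_j\subset V_{j+1}$, $f\in V_j\Leftrightarrow f(2\,\cdot)\in V_{j+1}$, $\bigcap_j V_j=\{0\}$, $\overline{\bigcup_j V_j}=L^2(\mathbb R)$, and $\{\phi(\cdot-k)\}_{k\in\mathbb Z}$ is an orthonormal basis of $V_0$; and that $\psi$ is an associated wavelet: $\{\psi(\cdot-k)\}_{k\in\mathbb Z}$ is an orthonormal basis of the orthogonal complement of $V_0$ in $V_1$. Write $f_{j,k}=2^{j/2}f(2^j\cdot-k)$. For $N\ge1$ let $\mathcal T_N$ be the span of the first $N$ elements of the list $$\phi_{0,-\lceil a\rceil+1},\dots,\phi_{0,\lceil a\rceil-1},\ \psi_{0,-\lceil a\rceil+1},\dots,\psi_{0,\lceil a\rceil-1},\ \psi_{1,-\lceil a\rceil+1},\dots,\psi_{1,2\lceil a\rceil-1},\ \dots$$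 (scale $j$ contributes $\psi_{j,k}$ for $-\lceil a\rceil+1\le k\le 2^j\lceil a\rceil-1$), and let $N_R=2^R\lceil a\rceil+(R+1)(\lceil a\rceil-1)$. Let $T_1\ge\lceil a\rceil-1$, $T_2\ge2\lceil a\rceil-1$, $0<\epsilon\le 1/(T_1+T_2)$ and, for $l\in\mathbb Z$, let $$s_l(x)=\sqrt\epsilon\,e^{2\pi i l\epsilon x}\,\chi_{[-T_1/(\epsilon(T_1+T_2)),\,T_2/(\epsilon(T_1+T_2))]}(x).$$ The vector of the first $M$ samples of $f\in L^2(\mathbb R)$ is $\hat f^{[M]}=(\langle f,s_l\rangle)_{-\lfloor M/2\rfloor\le l\le\lceil M/2\rceil-1}\in\mathbb C^M$. A map $G:L^2(\mathbb R)\to\mathcal T_N$ is a perfect method using $M$ samples if $G(f)$ depends only on $\hat f^{[M]}$ and $G(f)=f$ for all $f\in\mathcal T_N$; it need not be linear or continuous. Its condition number is $$\kappa(G)=\sup_{f\in L^2(\mathbb R)}\ \lim_{\delta\to0^+}\ \sup_{0<\|\hat g^{[M]}\|_{\ell^2}\le\delta}\frac{\|G(f+g)-G(f)\|}{\|\hat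 g^{[M]}\|_{\ell^2}}\in[0,\infty].$$ Theorem. For each $N\ge1$ let $G_N:L^2(\mathbb R)\to\mathcal T_N$ be a perfect method using $\Theta_G(N)\in\mathbb N$ samples, and suppose that the sampling ratio $\eta_G=\limsup_{N\to\infty}\Theta_G(N)/N$ satisfies $$1\le\eta_G<\frac1{\epsilon\lceil a\rceil}.$$ Then $\kappa(G_N)$ is unbounded as $N\to\infty$: for every $K<\infty$ there are infinitely many $N$ with $\kappa(G_N)>K$. Moreover, $\kappa(G_{N_R})$ grows at least exponentially in $N_R$: there is a constant $c>0$ such that $\kappa(G_{N_R})\ge e^{cN_R}$ for all sufficiently large $R$. -/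

import Mathlib

open MeasureTheory Filter Topology
open scoped ENNReal NNReal

noncomputable section

namespace WaveletSampling

/-- The Hilbert space `L²(ℝ)` of complex-valued square-integrable functions. -/
abbrev L2R : Type := Lp ℂ 2 (volume : Measure ℝ)

theorem map_affine_volume (c b : ℝ) (hc : c ≠ 0) :
    Measure.map (fun x : ℝ => c * x - b) volume = ENNReal.ofReal |c⁻¹| • volume := by
  have h : (fun x : ℝ => c * x - b) = (fun y => y - b) ∘ (fun x => c * x) := rfl
  rw [h, ← Measure.map_map (by fun_prop) (by fun_prop), Real.map_volume_mul_left hc,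
    Measure.map_smul, (measurePreserving_sub_right volume b).map_eq]

theorem memLp_affine (c b : ℝ) (hc : c ≠ 0) (f : L2R) :
    MemLp (fun x : ℝ => f (c * x - b)) 2 volume := by
  have h : MemLp f 2 (Measure.map (fun x : ℝ => c * x - b) volume) := by
    rw [map_affine_volume c b hc]
    exact (Lp.memLp f).smul_measure ENNReal.ofReal_ne_top
  exact (memLp_map_measure_iff h.aestronglyMeasurable (by fun_prop)).1 h

/-- The function `x ↦ f (c x - b)` as an element of `L²(ℝ)`. -/
def affineComp (c b : ℝ) (hc : c ≠ 0) (f : L2R) : L2R :=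
  (memLp_affine c b hc f).toLp

/-- The dilated translate `f_{j,k} = 2^{j/2} f(2^j · - k)`. -/
def dilTrans (f : L2R) (j k : ℤ) : L2R :=
  (((2 : ℝ) ^ ((j : ℝ) / 2) : ℝ) : ℂ) •
    affineComp ((2 : ℝ) ^ j) k (zpow_ne_zero j two_ne_zero) f

/-- The (essential) support of `f`: the complement of the largest open set on which `f`
vanishes almost everywhere. -/
def essSupport (f : L2R) : Set ℝ :=
  {x | ∀ U ∈ 𝓝 x, ¬ ((f : ℝ → ℂ) =ᵐ[volume.restrict U] 0)}

/-- `e` is an orthonormal (Hilbert) basis of the closed subspace `V`. -/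
def IsONBasisOf {ι : Type} (e : ι → L2R) (V : Submodule ℂ L2R) : Prop :=
  Orthonormal ℂ e ∧ (Submodule.span ℂ (Set.range e)).topologicalClosure = V

/-- `(V j)` is a multiresolution analysis of `L²(ℝ)` generated by the scaling function `φ`. -/
structure IsMRA (V : ℤ → Submodule ℂ L2R) (φ : L2R) : Prop where
  closed : ∀ j, IsClosed (V j : Set L2R)
  nested : ∀ j, V j ≤ V (j + 1)
  scaling : ∀ (j : ℤ) (f : L2R), f ∈ V j ↔ affineComp 2 0 two_ne_zero f ∈ V (j + 1)
  inter : ⨅ j, V j = ⊥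
  dense : (⨆ j, V j).topologicalClosure = ⊤
  basis : IsONBasisOf (fun k : ℤ => dilTrans φ 0 k) (V 0)

/-- `ψ` is an MRA wavelet with scaling function `φ`: the integer translates of `ψ` form an
orthonormal basis of the orthogonal complement of `V 0` in `V 1`, for a multiresolution analysis
`(V j)` generated by `φ`. -/
def IsMRAWavelet (φ ψ : L2R) : Prop :=
  ∃ V : ℤ → Submodule ℂ L2R, IsMRA V φ ∧
    IsONBasisOf (fun k : ℤ => dilTrans ψ 0 k) (V 1 ⊓ (V 0)ᗮ)

/-- `N_R = 2^R ⌈a⌉ + (R + 1)(⌈a⌉ - 1)`, for `A = ⌈a⌉ ≥ 1`. -/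
def NR (A R : ℕ) : ℕ := 2 ^ R * A + (R + 1) * (A - 1)

/-- The reconstruction space `T_N`, spanned by the first `N` of the functions
`φ_{0,-A+1}, …, φ_{0,A-1}, ψ_{0,-A+1}, …, ψ_{0,A-1}, ψ_{1,-A+1}, …, ψ_{1,2A-1}, …`
where `A = ⌈a⌉`, ordered by scale and then by translation.  Counted from `1`, the function
`φ_{0,k}` has position `k + A` in this list. There are `2 A - 1 = N_0` functions `φ_{0,k}` and
`(2^j + 1) A - 1 = N_{j+1} - N_j` functions `ψ_{j,k}` of scale `j`, so that `ψ_{j,k}` has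
position `N_j + k + A`. -/
def reconSpace (a : ℝ) (φ ψ : L2R) (N : ℕ) : Submodule ℂ L2R :=
  Submodule.span ℂ
    ({f | ∃ k : ℤ, -(⌈a⌉₊ : ℤ) + 1 ≤ k ∧ k ≤ (⌈a⌉₊ : ℤ) - 1 ∧ k + ⌈a⌉₊ ≤ N ∧
        f = dilTrans φ 0 k} ∪
     {f | ∃ (j : ℕ) (k : ℤ), -(⌈a⌉₊ : ℤ) + 1 ≤ k ∧ k ≤ 2 ^ j * (⌈a⌉₊ : ℤ) - 1 ∧
        (NR ⌈a⌉₊ j : ℤ) + k + ⌈a⌉₊ ≤ N ∧ f = dilTrans ψ j k})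

/-- The sampling function
`√ε e^{2πi l ε x}` on `[-T₁/(ε(T₁+T₂)), T₂/(ε(T₁+T₂))]`, and `0` elsewhere. -/
def samplingFun (T₁ T₂ ε : ℝ) (l : ℤ) : ℝ → ℂ :=
  (Set.Icc (-T₁ / (ε * (T₁ + T₂))) (T₂ / (ε * (T₁ + T₂)))).indicator
    fun x => (Real.sqrt ε : ℂ) * Complex.exp (2 * Real.pi * Complex.I * l * ε * x)

theorem memLp_samplingFun (T₁ T₂ ε : ℝ) (l : ℤ) :
    MemLp (samplingFun T₁ T₂ ε l) 2 volume := by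
  unfold samplingFun
  rw [memLp_indicator_iff_restrict measurableSet_Icc]
  have hc : Continuous
      fun x : ℝ => (Real.sqrt ε : ℂ) * Complex.exp (2 * Real.pi * Complex.I * l * ε * x) := by
    fun_prop
  obtain ⟨C, hC⟩ := isCompact_Icc.exists_bound_of_continuousOn
    (s := Set.Icc (-T₁ / (ε * (T₁ + T₂))) (T₂ / (ε * (T₁ + T₂)))) hc.continuousOn
  exact MemLp.of_bound hc.aestronglyMeasurable C
    ((ae_restrict_iff' measurableSet_Icc).2 (Eventually.of_forall hC))

/-- The sampling vector `s_l^ε`, as an element of `L²(ℝ)`. -/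
def samplingVec (T₁ T₂ ε : ℝ) (l : ℤ) : L2R := (memLp_samplingFun T₁ T₂ ε l).toLp

/-- The indices `-⌊M/2⌋ ≤ l ≤ ⌈M/2⌉ - 1` of the first `M` samples. -/
def sampleIndex (M : ℕ) : Finset ℤ := Finset.Icc (-⌊(M : ℝ) / 2⌋) (⌈(M : ℝ) / 2⌉ - 1)

/-- The vector of the first `M` samples `⟨f, s_l^ε⟩` of `f`, with its `ℓ²` norm. (The inner
product of Mathlib is conjugate-linear in the first argument, so this is
`∫ f(x) * conj (s_l^ε(x)) dx`.) -/
def samples (T₁ T₂ ε : ℝ) (M : ℕ) (f : L2R) : EuclideanSpace ℂ (sampleIndex M) :=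
  WithLp.toLp 2 fun l => inner ℂ (samplingVec T₁ T₂ ε l) f

/-- `G : L²(ℝ) → T` is a perfect method with respect to the sample map `s`. -/
structure IsPerfectMethod {E : Type} (s : L2R → E) (T : Submodule ℂ L2R)
    (G : L2R → L2R) : Prop where
  mapsTo : ∀ f, G f ∈ T
  dependsOnSamples : ∀ f g, s f = s g → G f = G g
  perfect : ∀ f ∈ T, G f = f

/-- `sup { ‖G (f + g) - G f‖ / ‖ĝ‖ : g ∈ L²(ℝ), 0 < ‖ĝ‖ ≤ δ }`, where `ĝ = s g`. -/
def localCond {E : Type} [Norm E] (s : L2R → E) (G : L2R → L2R) (f : L2R) (δ : ℝ) : ℝ≥0∞ :=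
  ⨆ (g : L2R) (_ : 0 < ‖s g‖ ∧ ‖s g‖ ≤ δ), ENNReal.ofReal (‖G (f + g) - G f‖ / ‖s g‖)

/-- The condition number
`κ(G) = sup_f lim_{δ → 0+} sup_{0 < ‖ĝ‖ ≤ δ} ‖G (f + g) - G f‖ / ‖ĝ‖ ∈ [0, ∞]`.
The limit exists in `[0, ∞]`, see `tendsto_localCond`. -/
def condNumber {E : Type} [Norm E] (s : L2R → E) (G : L2R → L2R) : ℝ≥0∞ :=
  ⨆ f : L2R, limsup (localCond s G f) (𝓝[>] 0)

theorem tendsto_localCond {E : Type} [Norm E] (s : L2R → E) (G : L2R → L2R) (f : L2R) :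
    Tendsto (localCond s G f) (𝓝[>] 0) (𝓝 (limsup (localCond s G f) (𝓝[>] 0))) := by
  have hm : Monotone (localCond s G f) := fun δ₁ δ₂ h =>
    iSup_mono fun g => iSup_mono' fun hg => ⟨⟨hg.1, hg.2.trans h⟩, le_rfl⟩
  have ht := hm.tendsto_nhdsGT 0
  rw [ht.limsup_eq]
  exact ht

/-- The sampling ratio `η_G = limsup_{N → ∞} Θ_G(N) / N ∈ [0, ∞]` of a method which uses
`Θ_G(N)` samples to reconstruct in `T_N`. -/
def samplingRatio (Θ : ℕ → ℕ) : ℝ≥0∞ :=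
  limsup (fun N : ℕ => (Θ N : ℝ≥0∞) / (N : ℝ≥0∞)) atTop

end WaveletSampling

end

namespace WaveletSampling

/-! Write A = ⌈a⌉ and m = 2^R A - A. The sampling ratio bound keeps the normalized frequencies
lε/2^R of the samples within [-β, β] for some β < 1/2, while the reconstruction space contains
functions concentrated near frequency 1/2, which such samples barely see. The witness is f = ∑
(-1)^k C(m,k) φ_{R,k}, 0 ≤ k ≤ m (`binomialComb`). It lies in V_R and lives on [0, A], so its
wavelet expansion is finite and f is in T_{N_R} (`mem_reconSpace`). Orthonormality gives ‖f‖² ≥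
4^m/(m+1) (`norm_binomialComb_sq`). A translation modulates the Fourier samples, so by the binomial
theorem each sample is (1-ω)^m times one of φ_{R,0}, with |1-ω| ≤ 2σ and σ = sin(πβ) < 1
(`norm_inner_samplingVec_binomialComb_le`). A perfect method fixes all multiples of f, whence κ(G) ≥
‖f‖/‖samples of f‖ (`condNumber_ge`). This ratio is at least σ^{-m} up to polynomial factors, and m
≥ N_R/2 for large R. -/

/-! ### Essential supports and dilated translates -/

theorem ae_eq_zero_of_essSupport_subset {f : L2R} {s : Set ℝ} (h : essSupport f ⊆ s) :
    ∀ᵐ x, x ∉ s → f x = 0 := by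
  have h0 : volume ({x : ℝ | f x ≠ 0} ∩ sᶜ) = 0 := by
    -- The line is second countable, so local nullity off the essential support gives nullity.
    refine measure_null_of_locally_null _ fun x hx => ?_
    have hx' : x ∉ essSupport f := fun h' => hx.2 (h h')
    simp only [essSupport, Set.mem_ofPred_eq, not_forall, not_not] at hx'
    obtain ⟨U, hU, hfU⟩ := hx'
    refine ⟨{x : ℝ | f x ≠ 0} ∩ sᶜ ∩ U, Filter.inter_mem self_mem_nhdsWithin
      (mem_nhdsWithin_of_mem_nhds hU), ?_⟩
    have h1 : (volume.restrict U) {x : ℝ | f x ≠ 0} = 0 := hfU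
    refine measure_mono_null ?_ (le_antisymm ((Measure.le_restrict_apply _ _).trans h1.le) bot_le)
    exact Set.inter_subset_inter_left _ Set.inter_subset_left
  rw [ae_iff]
  refine measure_mono_null (fun x hx => ?_) h0
  simp only [Set.mem_ofPred_eq, Classical.not_imp] at hx
  exact ⟨hx.2, hx.1⟩

theorem quasiMeasurePreserving_affine (c b : ℝ) (hc : c ≠ 0) :
    Measure.QuasiMeasurePreserving (fun x : ℝ => c * x - b) volume volume := by
  refine ⟨by fun_prop, ?_⟩
  rw [map_affine_volume c b hc]
  exact Measure.smul_absolutelyContinuous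

theorem coeFn_affineComp (c b : ℝ) (hc : c ≠ 0) (f : L2R) :
    affineComp c b hc f =ᵐ[volume] fun x => f (c * x - b) :=
  (memLp_affine c b hc f).coeFn_toLp

theorem coeFn_dilTrans (f : L2R) (j k : ℤ) :
    dilTrans f j k =ᵐ[volume]
      fun x => (((2 : ℝ) ^ ((j : ℝ) / 2) : ℝ) : ℂ) * f ((2 : ℝ) ^ j * x - k) := by
  filter_upwards [Lp.coeFn_smul (((2 : ℝ) ^ ((j : ℝ) / 2) : ℝ) : ℂ)
    (affineComp ((2 : ℝ) ^ j) k (zpow_ne_zero j two_ne_zero) f),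
    coeFn_affineComp ((2 : ℝ) ^ j) k (zpow_ne_zero j two_ne_zero) f] with x h1 h2
  rw [dilTrans, h1, Pi.smul_apply, h2, smul_eq_mul]

theorem dilTrans_ae_eq_zero {f : L2R} {s : Set ℝ} (hf : ∀ᵐ x, x ∉ s → f x = 0) (j k : ℤ) :
    ∀ᵐ x : ℝ, (2 : ℝ) ^ j * x - k ∉ s → dilTrans f j k x = 0 := by
  filter_upwards [coeFn_dilTrans f j k, (quasiMeasurePreserving_affine ((2 : ℝ) ^ j) k
    (zpow_ne_zero j two_ne_zero)).ae hf] with x h1 h2 hx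
  rw [h1, h2 hx, mul_zero]

theorem inner_eq_zero_of_ae {f g : L2R} (h : ∀ᵐ x, f x = 0 ∨ g x = 0) : inner ℂ f g = 0 := by
  rw [L2.inner_def]
  refine integral_eq_zero_of_ae ?_
  filter_upwards [h] with x hx
  rcases hx with hx | hx <;> simp [hx]

/-- The unnormalized dyadic dilation `f ↦ f (2 ·)` on `L²(ℝ)`. -/
noncomputable abbrev dyadicDil (f : L2R) : L2R := affineComp 2 0 two_ne_zero f

theorem coeFn_dyadicDil (f : L2R) : dyadicDil f =ᵐ[volume] fun x => f (2 * x) := by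
  filter_upwards [coeFn_affineComp 2 0 two_ne_zero f] with x hx
  rw [hx, sub_zero]

theorem dyadicDil_surjective (f : L2R) : ∃ g, dyadicDil g = f := by
  refine ⟨affineComp (1 / 2) 0 (by norm_num) f, ?_⟩
  apply Lp.ext
  filter_upwards [coeFn_dyadicDil (affineComp (1 / 2) 0 (by norm_num) f),
    (quasiMeasurePreserving_affine 2 0 two_ne_zero).ae
      (coeFn_affineComp (1 / 2) 0 (by norm_num) f)] with x h1 h2
  rw [h1]
  simp only [sub_zero] at h2
  rw [h2]
  congr 1
  ring

theorem inner_dyadicDil (f g : L2R) :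
    inner ℂ (dyadicDil f) (dyadicDil g) = (1 / 2 : ℂ) * inner ℂ f g := by
  rw [L2.inner_def, L2.inner_def]
  have h : ∫ x, inner ℂ (dyadicDil f x) (dyadicDil g x) =
      ∫ x, (fun y => inner ℂ (f y) (g y)) (2 * x) := by
    refine integral_congr_ae ?_
    filter_upwards [coeFn_dyadicDil f, coeFn_dyadicDil g] with x h1 h2
    rw [h1, h2]
  rw [h, Measure.integral_comp_mul_left (fun y => inner ℂ (f y) (g y)) 2]
  simp

theorem dilTrans_add_one (f : L2R) (j k : ℤ) :
    dilTrans f (j + 1) k = ((Real.sqrt 2 : ℝ) : ℂ) • dyadicDil (dilTrans f j k) := by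
  apply Lp.ext
  filter_upwards [coeFn_dilTrans f (j + 1) k, Lp.coeFn_smul ((Real.sqrt 2 : ℝ) : ℂ)
    (dyadicDil (dilTrans f j k)), coeFn_dyadicDil (dilTrans f j k),
    (quasiMeasurePreserving_affine 2 0 two_ne_zero).ae (coeFn_dilTrans f j k)] with x h1 h2 h3 h4
  rw [h1, h2, Pi.smul_apply, h3]
  rw [sub_zero] at h4
  rw [h4, smul_eq_mul, ← mul_assoc]
  have e1 : (2 : ℝ) ^ (((j + 1 : ℤ) : ℝ) / 2) = Real.sqrt 2 * (2 : ℝ) ^ ((j : ℝ) / 2) := by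
    rw [Real.sqrt_eq_rpow, ← Real.rpow_add two_pos]
    congr 1
    push_cast
    ring
  have e2 : (2 : ℝ) ^ (j + 1) * x = (2 : ℝ) ^ j * (2 * x) := by
    rw [zpow_add_one₀ two_ne_zero]
    ring
  rw [e1, e2]
  push_cast
  rfl

/-- The two factors √2 cancel the Jacobian 1/2 of the dilation. -/
theorem inner_dilTrans_add_one (f g : L2R) (j k k' : ℤ) :
    inner ℂ (dilTrans f (j + 1) k) (dilTrans g (j + 1) k') =
      inner ℂ (dilTrans f j k) (dilTrans g j k') := by
  rw [dilTrans_add_one, dilTrans_add_one, inner_smul_left, inner_smul_right, inner_dyadicDil,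
    Complex.conj_ofReal, ← mul_assoc, ← mul_assoc, ← Complex.ofReal_mul,
    Real.mul_self_sqrt two_pos.le]
  simp

theorem orthonormal_dilTrans {f : L2R} (hf : Orthonormal ℂ fun k : ℤ => dilTrans f 0 k) (j : ℕ) :
    Orthonormal ℂ fun k : ℤ => dilTrans f j k := by
  induction j with
  | zero => exact hf
  | succ j ih =>
    rw [orthonormal_iff_ite] at ih ⊢
    intro k k'
    rw [← ih k k']
    push_cast
    exact inner_dilTrans_add_one f f j k k'

theorem eq_zero_of_mem_closure_span {ι : Type} {e : ι → L2R} {f : L2R}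
    (hf : f ∈ (Submodule.span ℂ (Set.range e)).topologicalClosure)
    (h : ∀ i, inner ℂ (e i) f = 0) : f = 0 := by
  have h1 : f ∈ (Submodule.span ℂ (Set.range e))ᗮ := by
    rw [Submodule.mem_orthogonal]
    intro u hu
    induction hu using Submodule.span_induction with
    | mem x hx => obtain ⟨i, rfl⟩ := hx; exact h i
    | zero => simp
    | add x y _ _ hx hy => rw [inner_add_left, hx, hy, add_zero]
    | smul c x _ hx => rw [inner_smul_left, hx, mul_zero]
  have h2 : f ∈ ((Submodule.span ℂ (Set.range e)).topologicalClosure)ᗮ := by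
    rwa [Submodule.orthogonal_closure]
  exact inner_self_eq_zero.1 ((Submodule.mem_orthogonal _ _).1 h2 f hf)

/-- Subtracting from `f` its components along finitely many members of an orthonormal family. -/
theorem inner_sub_sum_eq_zero {ι : Type} {e : ι → L2R} (he : Orthonormal ℂ e) (s : Finset ι)
    {f : L2R} (hf : ∀ i ∉ s, inner ℂ (e i) f = 0) (i : ι) :
    inner ℂ (e i) (f - ∑ k ∈ s, inner ℂ (e k) f • e k) = 0 := by
  classical
  rw [inner_sub_right, inner_sum]
  simp_rw [inner_smul_right, orthonormal_iff_ite.1 he i]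
  by_cases hi : i ∈ s
  · simp [hi]
  · simp [hi, hf i hi]

/-! ### Finite wavelet expansions in a multiresolution analysis -/

section MRA

variable {V : ℤ → Submodule ℂ L2R} {φ ψ : L2R}

theorem IsMRA.dilTrans_mem (hV : IsMRA V φ) (j : ℕ) (k : ℤ) : dilTrans φ j k ∈ V j := by
  induction j with
  | zero =>
    rw [Nat.cast_zero, ← hV.basis.2]
    exact Submodule.le_topologicalClosure _ (Submodule.subset_span ⟨k, rfl⟩)
  | succ j ih =>
    push_cast
    rw [dilTrans_add_one]
    exact Submodule.smul_mem _ _ ((hV.scaling _ _).1 ih)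

theorem IsMRA.mono_nat (hV : IsMRA V φ) : Monotone fun j : ℕ => V j :=
  monotone_nat_of_le_succ fun j => by
    push_cast
    exact hV.nested j

theorem IsMRA.wavelet_mem (hV : IsMRA V φ)
    (hψ : IsONBasisOf (fun k : ℤ => dilTrans ψ 0 k) (V 1 ⊓ (V 0)ᗮ)) (j : ℕ) (k : ℤ) :
    dilTrans ψ j k ∈ V (j + 1) ⊓ (V j)ᗮ := by
  induction j with
  | zero =>
    rw [Nat.cast_zero, zero_add, ← hψ.2]
    exact Submodule.le_topologicalClosure _ (Submodule.subset_span ⟨k, rfl⟩)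
  | succ j ih =>
    push_cast
    rw [dilTrans_add_one]
    refine Submodule.smul_mem _ _ ⟨(hV.scaling _ _).1 ih.1, ?_⟩
    rw [SetLike.mem_coe, Submodule.mem_orthogonal]
    intro u hu
    obtain ⟨v, rfl⟩ := dyadicDil_surjective u
    rw [inner_dyadicDil, (Submodule.mem_orthogonal _ _).1 ih.2 v ((hV.scaling _ _).2 hu), mul_zero]

/-- At scale 0, the component of `f` orthogonal to `V 0` lies in the closed span of the translates
of ψ and is orthogonal to each of them, hence is zero. Dilation carries this to all scales. -/
theorem IsMRA.mem_of_inner_wavelet_eq_zero (hV : IsMRA V φ)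
    (hψ : IsONBasisOf (fun k : ℤ => dilTrans ψ 0 k) (V 1 ⊓ (V 0)ᗮ)) (j : ℕ) {f : L2R}
    (hf : f ∈ V (j + 1)) (h : ∀ k : ℤ, inner ℂ (dilTrans ψ j k) f = 0) : f ∈ V j := by
  induction j generalizing f with
  | zero =>
    simp only [Nat.cast_zero, zero_add] at hf h ⊢
    have : CompleteSpace (V 0) := (hV.closed 0).completeSpace_coe
    obtain ⟨p, hp, q, hq, rfl⟩ := (V 0).exists_add_mem_mem_orthogonal f
    have hq1 : q ∈ V 1 := by
      have := (V 1).sub_mem hf (hV.nested 0 hp)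
      rwa [add_sub_cancel_left] at this
    have hq0 : q = 0 := by
      refine eq_zero_of_mem_closure_span (e := fun k : ℤ => dilTrans ψ 0 k) ?_ fun k => ?_
      · rw [hψ.2]
        exact ⟨hq1, hq⟩
      · have h1 := h k
        have h2 : dilTrans ψ 0 k ∈ V 1 ⊓ (V 0)ᗮ := hV.wavelet_mem hψ 0 k
        rw [inner_add_right, (Submodule.mem_orthogonal' _ _).1 h2.2 p hp, zero_add] at h1
        exact h1
    rwa [hq0, add_zero]
  | succ j ih =>
    push_cast at hf h ⊢
    obtain ⟨g, rfl⟩ := dyadicDil_surjective f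
    refine (hV.scaling _ _).1 (ih ((hV.scaling _ _).2 hf) fun k => ?_)
    have h1 := h k
    rw [dilTrans_add_one, inner_smul_left, inner_dyadicDil] at h1
    simpa using h1

/-- An element of `V R` with only finitely many nonzero coefficients in the wavelet basis is
in the span of the corresponding basis elements. -/
theorem IsMRA.mem_span (hV : IsMRA V φ)
    (hψ : IsONBasisOf (fun k : ℤ => dilTrans ψ 0 k) (V 1 ⊓ (V 0)ᗮ)) (T : Submodule ℂ L2R)
    (s : Finset ℤ) (t : ℕ → Finset ℤ) (hs : ∀ k ∈ s, dilTrans φ 0 k ∈ T) (R : ℕ)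
    (ht : ∀ j < R, ∀ k ∈ t j, dilTrans ψ j k ∈ T) {f : L2R} (hf : f ∈ V R)
    (hfs : ∀ k ∉ s, inner ℂ (dilTrans φ 0 k) f = 0)
    (hft : ∀ j < R, ∀ k ∉ t j, inner ℂ (dilTrans ψ j k) f = 0) : f ∈ T := by
  induction R generalizing f with
  | zero =>
    rw [Nat.cast_zero] at hf
    have h0 : f - ∑ k ∈ s, inner ℂ (dilTrans φ 0 k) f • dilTrans φ 0 k = 0 := by
      refine eq_zero_of_mem_closure_span (e := fun k : ℤ => dilTrans φ 0 k) ?_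
        (inner_sub_sum_eq_zero hV.basis.1 s hfs)
      rw [hV.basis.2]
      exact Submodule.sub_mem _ hf (Submodule.sum_mem _ fun k _ =>
        Submodule.smul_mem _ _ (hV.dilTrans_mem 0 k))
    rw [sub_eq_zero] at h0
    rw [h0]
    exact Submodule.sum_mem _ fun k hk => Submodule.smul_mem _ _ (hs k hk)
  | succ R ih =>
    push_cast at hf
    set g := ∑ k ∈ t R, inner ℂ (dilTrans ψ R k) f • dilTrans ψ R k with hg
    have hgW : g ∈ V (R + 1) ⊓ (V R)ᗮ := Submodule.sum_mem _ fun k _ =>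
      Submodule.smul_mem _ _ (hV.wavelet_mem hψ R k)
    have hgT : g ∈ T := Submodule.sum_mem _ fun k hk =>
      Submodule.smul_mem _ _ (ht R (Nat.lt_succ_self R) k hk)
    -- Removing the finest scale `g` leaves all coarser coefficients unchanged, so the induction
    -- hypothesis applies to `f - g`.
    have hperp : ∀ u ∈ V R, inner ℂ u g = 0 := (Submodule.mem_orthogonal _ _).1 hgW.2
    have hfg : f - g ∈ V R := by
      refine hV.mem_of_inner_wavelet_eq_zero hψ R (Submodule.sub_mem _ hf hgW.1) fun k => ?_
      exact inner_sub_sum_eq_zero (orthonormal_dilTrans hψ.1 R) (t R)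
        (hft R (Nat.lt_succ_self R)) k
    have := ih (fun j hj => ht j (hj.trans (Nat.lt_succ_self R))) hfg
      (fun k hk => ?_) (fun j hj k hk => ?_)
    · rw [← sub_add_cancel f g]
      exact T.add_mem this hgT
    · have hm : dilTrans φ 0 k ∈ V R := hV.mono_nat (Nat.zero_le R) (hV.dilTrans_mem 0 k)
      rw [inner_sub_right, hfs k hk, hperp _ hm, sub_zero]
    · have hm : dilTrans ψ j k ∈ V R := by
        have := hV.mono_nat (Nat.succ_le_of_lt hj)
        simp only [Nat.succ_eq_add_one, Nat.cast_add, Nat.cast_one] at this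
        exact this (hV.wavelet_mem hψ j k).1
      rw [inner_sub_right, hft j (hj.trans (Nat.lt_succ_self R)) k hk, hperp _ hm, sub_zero]

end MRA

/-! ### Membership in the reconstruction space -/

theorem NR_succ (A j : ℕ) : NR A (j + 1) = NR A j + 2 ^ j * A + (A - 1) := by
  unfold NR
  ring

theorem monotone_NR (A : ℕ) : Monotone (NR A) :=
  monotone_nat_of_le_succ fun j => by
    rw [NR_succ A j, add_assoc]
    exact Nat.le_add_right _ _

/-- The elements of `V R` supported in `[0, ⌈a⌉]` belong to the reconstruction space of
dimension `N_R`. -/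
theorem mem_reconSpace {V : ℤ → Submodule ℂ L2R} {φ ψ : L2R} {a : ℝ} (ha : 1 ≤ a)
    (hV : IsMRA V φ) (hψ : IsONBasisOf (fun k : ℤ => dilTrans ψ 0 k) (V 1 ⊓ (V 0)ᗮ))
    (hφ0 : ∀ᵐ x, x ∉ Set.Icc 0 a → φ x = 0) (hψ0 : ∀ᵐ x, x ∉ Set.Icc 0 a → ψ x = 0)
    (R : ℕ) {f : L2R} (hf : f ∈ V R) (hf0 : ∀ᵐ x : ℝ, x ∉ Set.Icc 0 (⌈a⌉₊ : ℝ) → f x = 0) :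
    f ∈ reconSpace a φ ψ (NR ⌈a⌉₊ R) := by
  have hA : 1 ≤ ⌈a⌉₊ := Nat.one_le_ceil_iff.2 (by linarith)
  have haA : a ≤ ⌈a⌉₊ := Nat.le_ceil a
  set A := ⌈a⌉₊ with hAdef
  have key : ∀ (g : L2R), (∀ᵐ x, x ∉ Set.Icc 0 a → g x = 0) → ∀ (j : ℕ) (k : ℤ),
      k ∉ Finset.Icc (-(A : ℤ) + 1) (2 ^ j * (A : ℤ) - 1) → inner ℂ (dilTrans g j k) f = 0 := by
    intro g hg j k hk
    refine inner_eq_zero_of_ae ?_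
    -- For the extreme excluded indices k = -A and k = 2^j A the supports may still touch at an
    -- endpoint of [0, A]; discarding the endpoints makes the inequalities strict.
    have hbad : ∀ᵐ x : ℝ, x ≠ 0 ∧ x ≠ A := by
      have h1 : ∀ᵐ x : ℝ, x ≠ 0 := by simp [ae_iff]
      have h2 : ∀ᵐ x : ℝ, x ≠ A := by simp [ae_iff]
      exact h1.and h2
    filter_upwards [dilTrans_ae_eq_zero hg j k, hf0, hbad] with x h1 h2 h3
    by_cases hx : x ∈ Set.Icc 0 (A : ℝ)
    · left
      apply h1
      rintro ⟨h4, h5⟩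
      apply hk
      rw [zpow_natCast] at h4 h5
      have hx0 : 0 < x := lt_of_le_of_ne hx.1 (Ne.symm h3.1)
      have hxA : x < A := lt_of_le_of_ne hx.2 h3.2
      have hp : (0 : ℝ) < 2 ^ j := by positivity
      have h6 : (k : ℝ) < 2 ^ j * A := by nlinarith
      have h7 : -(A : ℝ) < k := by nlinarith [mul_pos hp hx0]
      have h6' : k < 2 ^ j * (A : ℤ) := by exact_mod_cast h6
      have h7' : -(A : ℤ) < k := by exact_mod_cast h7
      rw [Finset.mem_Icc]
      constructor <;> omega
    · exact Or.inr (h2 hx)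
  refine hV.mem_span hψ _ (Finset.Icc (-(A : ℤ) + 1) (2 ^ 0 * (A : ℤ) - 1))
    (fun j => Finset.Icc (-(A : ℤ) + 1) (2 ^ j * (A : ℤ) - 1)) (fun k hk => ?_) R
    (fun j hj k hk => ?_) hf (key φ hφ0 0) (fun j _ => key ψ hψ0 j)
  · rw [Finset.mem_Icc] at hk
    refine Submodule.subset_span (Or.inl ⟨k, hk.1, by simpa using hk.2, ?_, rfl⟩)
    have h0 := monotone_NR A (Nat.zero_le R)
    have : NR A 0 = 2 * A - 1 := by
      unfold NR
      omega
    simp only [pow_zero, one_mul] at hk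
    omega
  · rw [Finset.mem_Icc] at hk
    refine Submodule.subset_span (Or.inr ⟨j, k, hk.1, hk.2, ?_, rfl⟩)
    -- The last wavelet of scale `j` has position N_{j+1}, and N_{j+1} ≤ N_R.
    have h0 := monotone_NR A (Nat.succ_le_of_lt hj)
    rw [Nat.succ_eq_add_one, NR_succ A j] at h0
    zify [hA] at h0
    linarith [hk.2]

/-! ### Lower bound for the condition number -/

/-- `G` is the identity on the line through `f`, so perturbing 0 along it gives the same quotient at
every radius; linearity of `G` plays no role. If the samples of `f` vanished, then f = G f = G 0 =
0. -/
theorem condNumber_ge {E : Type} [NormedAddCommGroup E] [NormedSpace ℂ E] {s : L2R → E}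
    (hs : IsLinearMap ℂ s) {T : Submodule ℂ L2R} {G : L2R → L2R} (hG : IsPerfectMethod s T G)
    {f : L2R} (hf : f ∈ T) (hf0 : f ≠ 0) :
    0 < ‖s f‖ ∧ ENNReal.ofReal (‖f‖ / ‖s f‖) ≤ condNumber s G := by
  have hpos : 0 < ‖s f‖ := by
    rw [norm_pos_iff]
    intro h
    apply hf0
    rw [← hG.perfect f hf, hG.dependsOnSamples f 0 (by rw [h, hs.map_zero]),
      hG.perfect 0 T.zero_mem]
  refine ⟨hpos, ?_⟩
  unfold condNumber
  refine le_trans ?_ (le_iSup _ (0 : L2R))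
  refine le_limsup_of_frequently_le (Eventually.frequently ?_)
  filter_upwards [self_mem_nhdsWithin] with δ hδ
  have hδ : 0 < δ := hδ
  -- The samples of `t • f` have norm exactly δ.
  set t : ℝ := δ / ‖s f‖
  have ht : 0 < t := by positivity
  have hst : ‖s ((t : ℂ) • f)‖ = t * ‖s f‖ := by
    rw [hs.map_smul, norm_smul, Complex.norm_real, Real.norm_of_nonneg ht.le]
  have hmem : 0 < ‖s ((t : ℂ) • f)‖ ∧ ‖s ((t : ℂ) • f)‖ ≤ δ := by
    rw [hst]
    exact ⟨by positivity, (div_mul_cancel₀ δ hpos.ne').le⟩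
  unfold localCond
  refine le_trans (le_of_eq ?_) (le_iSup₂ ((t : ℂ) • f) hmem)
  rw [zero_add, hG.perfect _ (T.smul_mem _ hf), hG.perfect 0 T.zero_mem, sub_zero, hst, norm_smul,
    Complex.norm_real, Real.norm_of_nonneg ht.le, mul_div_mul_left _ _ ht.ne']

/-! ### Fourier samples of translates -/

theorem isLinearMap_samples (T₁ T₂ ε : ℝ) (M : ℕ) : IsLinearMap ℂ (samples T₁ T₂ ε M) where
  map_add f g := by
    ext l
    simp [samples, inner_add_right]
  map_smul c f := by
    ext l
    simp [samples, inner_smul_right]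

theorem abs_le_of_mem_sampleIndex {M : ℕ} {l : ℤ} (hl : l ∈ sampleIndex M) :
    |(l : ℝ)| ≤ (M : ℝ) / 2 := by
  rw [sampleIndex, Finset.mem_Icc] at hl
  have h1 : (-⌊(M : ℝ) / 2⌋ : ℝ) ≤ l := by exact_mod_cast hl.1
  have h2 : (l : ℝ) ≤ ⌈(M : ℝ) / 2⌉ - 1 := by exact_mod_cast hl.2
  have h3 := Int.floor_le ((M : ℝ) / 2)
  have h4 := Int.ceil_lt_add_one ((M : ℝ) / 2)
  rw [abs_le]
  constructor <;> linarith

theorem card_sampleIndex_le (M : ℕ) : (sampleIndex M).card ≤ M + 1 := by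
  have h : (((sampleIndex M).card : ℤ) : ℝ) < M + 1 := by
    rw [sampleIndex, Int.card_Icc]
    have h3 := Int.floor_le ((M : ℝ) / 2)
    have h4 := Int.ceil_lt_add_one ((M : ℝ) / 2)
    rw [Int.toNat_eq_max]
    push_cast
    rw [max_lt_iff]
    constructor
    · linarith
    · positivity
  exact_mod_cast h.le

theorem norm_samples_le {T₁ T₂ ε : ℝ} {M : ℕ} {f : L2R} {B : ℝ}
    (h : ∀ l ∈ sampleIndex M, ‖(inner ℂ (samplingVec T₁ T₂ ε l) f : ℂ)‖ ≤ B) :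
    ‖samples T₁ T₂ ε M f‖ ^ 2 ≤ (M + 1) * B ^ 2 := by
  rw [EuclideanSpace.norm_sq_eq]
  calc ∑ l : sampleIndex M, ‖samples T₁ T₂ ε M f l‖ ^ 2
      ≤ ∑ _l : sampleIndex M, B ^ 2 :=
        Finset.sum_le_sum fun l _ => pow_le_pow_left₀ (norm_nonneg _) (h l l.2) 2
    _ = (sampleIndex M).card * B ^ 2 := by simp
    _ ≤ (M + 1) * B ^ 2 :=
        mul_le_mul_of_nonneg_right (by exact_mod_cast card_sampleIndex_le M) (sq_nonneg B)

/-- The modulus of s_l does not depend on l; this makes the later sample bounds uniform in l. -/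
theorem norm_samplingVec_le (T₁ T₂ ε : ℝ) (l : ℤ) :
    ‖samplingVec T₁ T₂ ε l‖ ≤ ‖samplingVec T₁ T₂ ε 0‖ := by
  refine Lp.norm_le_norm_of_ae_le ?_
  filter_upwards [(memLp_samplingFun T₁ T₂ ε l).coeFn_toLp,
    (memLp_samplingFun T₁ T₂ ε 0).coeFn_toLp] with x h1 h2
  rw [samplingVec, h1, samplingVec, h2]
  unfold samplingFun
  by_cases hx : x ∈ Set.Icc (-T₁ / (ε * (T₁ + T₂))) (T₂ / (ε * (T₁ + T₂)))
  · rw [Set.indicator_of_mem hx, Set.indicator_of_mem hx, norm_mul, norm_mul]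
    have : (2 * Real.pi * Complex.I * l * ε * x : ℂ) =
        ((2 * Real.pi * l * ε * x : ℝ) : ℂ) * Complex.I := by
      push_cast
      ring
    rw [this, Complex.norm_exp_ofReal_mul_I]
    simp
  · rw [Set.indicator_of_notMem hx, Set.indicator_of_notMem hx]

theorem inner_samplingVec {T₁ T₂ ε : ℝ} (l : ℤ) {g : L2R}
    (hg : ∀ᵐ x, x ∉ Set.Icc (-T₁ / (ε * (T₁ + T₂))) (T₂ / (ε * (T₁ + T₂))) → g x = 0) :
    inner ℂ (samplingVec T₁ T₂ ε l) g =
      ∫ x : ℝ, (Real.sqrt ε : ℂ) * Complex.exp (-(2 * Real.pi * Complex.I * l * ε * x)) * g x := by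
  rw [L2.inner_def]
  refine integral_congr_ae ?_
  filter_upwards [hg, (memLp_samplingFun T₁ T₂ ε l).coeFn_toLp] with x h1 h2
  rw [samplingVec, h2]
  unfold samplingFun
  by_cases hx : x ∈ Set.Icc (-T₁ / (ε * (T₁ + T₂))) (T₂ / (ε * (T₁ + T₂)))
  · rw [Set.indicator_of_mem hx, RCLike.inner_apply', map_mul, Complex.conj_ofReal,
      ← Complex.exp_conj]
    congr 3
    simp [map_ofNat (starRingEnd ℂ) 2]
  · rw [h1 hx]
    simp

/-- Translation becomes modulation on the Fourier side. The support hypotheses remove the sampling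
window, which is not translation invariant. -/
theorem inner_samplingVec_dilTrans {T₁ T₂ ε : ℝ} (l : ℤ) (φ : L2R) (j k : ℤ)
    (hk : ∀ᵐ x, x ∉ Set.Icc (-T₁ / (ε * (T₁ + T₂))) (T₂ / (ε * (T₁ + T₂))) →
      dilTrans φ j k x = 0)
    (h0 : ∀ᵐ x, x ∉ Set.Icc (-T₁ / (ε * (T₁ + T₂))) (T₂ / (ε * (T₁ + T₂))) →
      dilTrans φ j 0 x = 0) :
    inner ℂ (samplingVec T₁ T₂ ε l) (dilTrans φ j k) =
      Complex.exp (((-(2 * Real.pi * (l * ε / 2 ^ j)) * k : ℝ) : ℂ) * Complex.I) *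
        inner ℂ (samplingVec T₁ T₂ ε l) (dilTrans φ j 0) := by
  rw [inner_samplingVec l hk, inner_samplingVec l h0, ← integral_const_mul]
  have h2 : (2 : ℝ) ^ j ≠ 0 := zpow_ne_zero j two_ne_zero
  set H : ℤ → ℝ → ℂ := fun k x =>
    (Real.sqrt ε : ℂ) * Complex.exp (-(2 * Real.pi * Complex.I * l * ε * x)) *
      ((((2 : ℝ) ^ ((j : ℝ) / 2) : ℝ) : ℂ) * φ ((2 : ℝ) ^ j * x - k)) with hH
  have e1 : ∫ x : ℝ, (Real.sqrt ε : ℂ) *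
      Complex.exp (-(2 * Real.pi * Complex.I * l * ε * x)) * dilTrans φ j k x = ∫ x, H k x := by
    refine integral_congr_ae ?_
    filter_upwards [coeFn_dilTrans φ j k] with x hx
    rw [hx]
  have e2 : ∀ c : ℂ, ∫ x : ℝ, c * ((Real.sqrt ε : ℂ) *
      Complex.exp (-(2 * Real.pi * Complex.I * l * ε * x)) * dilTrans φ j 0 x) =
        ∫ x, c * H 0 x := by
    intro c
    refine integral_congr_ae ?_
    filter_upwards [coeFn_dilTrans φ j 0] with x hx
    rw [hx]
  rw [e1, e2, ← integral_sub_right_eq_self (fun x => _ * H 0 x) ((k : ℝ) / 2 ^ j)]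
  refine integral_congr_ae (Eventually.of_forall fun x => ?_)
  simp only [hH]
  have e3 : (2 : ℝ) ^ j * (x - k / 2 ^ j) - (0 : ℤ) = 2 ^ j * x - k := by
    field_simp
    simp
  have e4 : Complex.exp (-(2 * Real.pi * Complex.I * l * ε * x)) =
      Complex.exp (((-(2 * Real.pi * (l * ε / 2 ^ j)) * k : ℝ) : ℂ) * Complex.I) *
        Complex.exp (-(2 * Real.pi * Complex.I * l * ε * ((x - k / 2 ^ j : ℝ) : ℂ))) := by
    rw [← Complex.exp_add]
    congr 1
    push_cast
    ring
  rw [e3, e4]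
  ring

/-- The left side equals 2|sin(πθ)|, and sine is increasing on [-π/2, π/2]; hence the restriction on
β. -/
theorem norm_one_sub_exp_le {θ β : ℝ} (h : |θ| ≤ β) (hβ : β ≤ 1 / 2) :
    ‖1 - Complex.exp (((-(2 * Real.pi * θ) : ℝ) : ℂ) * Complex.I)‖ ≤
      2 * Real.sin (Real.pi * β) := by
  rw [norm_sub_rev, mul_comm, Complex.norm_exp_I_mul_ofReal_sub_one, norm_mul, Real.norm_eq_abs,
    Real.norm_eq_abs, abs_two]
  have h1 : -(2 * Real.pi * θ) / 2 = -(Real.pi * θ) := by ring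
  rw [h1, Real.sin_neg, abs_neg]
  have hpi := Real.pi_pos
  have hl := neg_abs_le θ
  have hr := le_abs_self θ
  refine mul_le_mul_of_nonneg_left (abs_le.2 ⟨?_, ?_⟩) two_pos.le
  · rw [← Real.sin_neg]
    apply Real.sin_le_sin_of_le_of_le_pi_div_two <;> nlinarith
  · apply Real.sin_le_sin_of_le_of_le_pi_div_two <;> nlinarith

/-! ### The test function -/

/-- Alternating binomial combination of the translates `φ_{R,k}`, `0 ≤ k ≤ m`. -/
noncomputable def binomialComb (φ : L2R) (R m : ℕ) : L2R :=
  ∑ k ∈ Finset.range (m + 1), ((-1 : ℂ) ^ k * (m.choose k : ℂ)) • dilTrans φ R k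

/-- The squared norm is ∑ C(m,k)²; Cauchy–Schwarz against ∑ C(m,k) = 2^m costs only the factor m +
1. -/
theorem norm_binomialComb_sq {φ : L2R} (hφ : Orthonormal ℂ fun k : ℤ => dilTrans φ 0 k)
    (R m : ℕ) : (4 : ℝ) ^ m ≤ (m + 1) * ‖binomialComb φ R m‖ ^ 2 := by
  have ho : Orthonormal ℂ fun k : ℕ => dilTrans φ R (k : ℤ) :=
    (orthonormal_dilTrans hφ R).comp (fun k : ℕ => (k : ℤ)) Nat.cast_injective
  have h1 : ‖binomialComb φ R m‖ ^ 2 = ∑ k ∈ Finset.range (m + 1), (m.choose k : ℝ) ^ 2 := by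
    have h2 : ((‖binomialComb φ R m‖ : ℂ)) ^ 2 =
        inner ℂ (binomialComb φ R m) (binomialComb φ R m) := by
      rw [inner_self_eq_norm_sq_to_K]
      rfl
    have h3 : (inner ℂ (binomialComb φ R m) (binomialComb φ R m) : ℂ) =
        ∑ k ∈ Finset.range (m + 1), (m.choose k : ℂ) ^ 2 := by
      unfold binomialComb
      rw [ho.inner_sum]
      refine Finset.sum_congr rfl fun k _ => ?_
      simp only [map_mul, map_pow, map_neg, map_one, map_natCast]
      rw [mul_mul_mul_comm, ← mul_pow]
      norm_num
      ring
    exact_mod_cast h2.trans h3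
  have h4 : ∑ k ∈ Finset.range (m + 1), (m.choose k : ℝ) = 2 ^ m := by
    exact_mod_cast Nat.sum_range_choose m
  have h5 := sq_sum_le_card_mul_sum_sq (s := Finset.range (m + 1)) (f := fun k => (m.choose k : ℝ))
  rw [h4, Finset.card_range] at h5
  rw [h1]
  push_cast at h5
  calc (4 : ℝ) ^ m = (2 ^ m) ^ 2 := by rw [← pow_mul, mul_comm, pow_mul]; norm_num
    _ ≤ _ := h5

/-- The k-th translate contributes ω^k, so the alternating sum collapses to (1-ω)^m times a single
sample. -/
theorem norm_inner_samplingVec_binomialComb_le {T₁ T₂ ε β : ℝ} {l : ℤ} {φ : L2R} {R m : ℕ}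
    (hφ : Orthonormal ℂ fun k : ℤ => dilTrans φ 0 k)
    (hsupp : ∀ k : ℕ, k ≤ m → ∀ᵐ x,
      x ∉ Set.Icc (-T₁ / (ε * (T₁ + T₂))) (T₂ / (ε * (T₁ + T₂))) → dilTrans φ R k x = 0)
    (hl : |l * ε / 2 ^ R| ≤ β) (hβ : β ≤ 1 / 2) :
    ‖(inner ℂ (samplingVec T₁ T₂ ε l) (binomialComb φ R m) : ℂ)‖ ≤
      (2 * Real.sin (Real.pi * β)) ^ m * ‖samplingVec T₁ T₂ ε 0‖ := by
  set ω : ℂ := Complex.exp (((-(2 * Real.pi * (l * ε / 2 ^ R)) : ℝ) : ℂ) * Complex.I) with hω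
  have h0 := hsupp 0 (Nat.zero_le m)
  rw [Nat.cast_zero] at h0
  have h1 : inner ℂ (samplingVec T₁ T₂ ε l) (binomialComb φ R m) =
      (1 - ω) ^ m * inner ℂ (samplingVec T₁ T₂ ε l) (dilTrans φ R 0) := by
    unfold binomialComb
    rw [inner_sum, sub_eq_neg_add, add_pow, Finset.sum_mul]
    refine Finset.sum_congr rfl fun k hk => ?_
    rw [inner_smul_right, inner_samplingVec_dilTrans l φ R k
      (hsupp k (Nat.lt_succ_iff.1 (Finset.mem_range.1 hk))) h0]
    have h2 : Complex.exp (((-(2 * Real.pi * (l * ε / 2 ^ (R : ℤ))) * (k : ℤ) : ℝ) : ℂ) *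
        Complex.I) = ω ^ k := by
      rw [hω, ← Complex.exp_nat_mul]
      congr 1
      push_cast
      rw [zpow_natCast]
      ring
    rw [h2, neg_pow ω]
    ring
  rw [h1, norm_mul, norm_pow]
  refine mul_le_mul (pow_le_pow_left₀ (norm_nonneg _) (norm_one_sub_exp_le hl hβ) m) ?_
    (norm_nonneg _) (pow_nonneg ((norm_nonneg _).trans (norm_one_sub_exp_le hl hβ)) m)
  refine (norm_inner_le_norm _ _).trans ?_
  rw [(orthonormal_dilTrans hφ R).1 0, mul_one]
  exact norm_samplingVec_le T₁ T₂ ε l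

/-! ### Asymptotics of dimensions and sample counts -/

theorem tendsto_two_pow_atTop : Tendsto (fun R : ℕ => (2 : ℝ) ^ R) atTop atTop :=
  tendsto_pow_atTop_atTop_of_one_lt one_lt_two

theorem tendsto_NR_div (A : ℕ) :
    Tendsto (fun R : ℕ => (NR A R : ℝ) / 2 ^ R) atTop (𝓝 A) := by
  have h1 : Tendsto (fun R : ℕ => (R : ℝ) / 2 ^ R) atTop (𝓝 0) := by
    simpa using tendsto_pow_const_div_const_pow_of_one_lt 1 (one_lt_two : (1 : ℝ) < 2)
  have h2 : Tendsto (fun R : ℕ => (1 : ℝ) / 2 ^ R) atTop (𝓝 0) :=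
    tendsto_const_nhds.div_atTop tendsto_two_pow_atTop
  have h3 := ((h1.add h2).mul_const ((A - 1 : ℕ) : ℝ)).const_add (A : ℝ)
  rw [add_zero, zero_mul, add_zero] at h3
  refine h3.congr fun R => ?_
  unfold NR
  push_cast
  field_simp

theorem tendsto_NR_atTop {A : ℕ} (hA : 1 ≤ A) : Tendsto (NR A) atTop atTop :=
  tendsto_atTop_mono (fun R => by
    unfold NR
    calc R ≤ 2 ^ R := Nat.lt_two_pow_self.le
      _ ≤ 2 ^ R * A := Nat.le_mul_of_pos_right _ hA
      _ ≤ _ := Nat.le_add_right _ _) tendsto_id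

/-- The number of translates `φ_{R,k}` supported in `[0, A]` is comparable to `N_R`. -/
theorem eventually_NR_le {A : ℕ} (hA : 1 ≤ A) :
    ∀ᶠ R : ℕ in atTop, NR A R ≤ 2 * (2 ^ R * A - A) := by
  have hA' : (0 : ℝ) < A := by exact_mod_cast hA
  have h1 : Tendsto (fun R : ℕ => (A : ℝ) / 2 ^ R) atTop (𝓝 0) :=
    tendsto_const_nhds.div_atTop tendsto_two_pow_atTop
  have h2 := (tendsto_NR_div A).add (h1.const_mul 2)
  -- Divided by 2^R, the claim N_R + 2A < 2A·2^R reads A < 2A in the limit.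
  have h3 : (A : ℝ) + 2 * 0 < 2 * A := by linarith
  filter_upwards [h2.eventually_lt_const h3] with R hR
  have hp : (0 : ℝ) < 2 ^ R := by positivity
  have h4 : (NR A R : ℝ) + 2 * A < 2 * A * 2 ^ R := by
    rw [← div_lt_iff₀ hp]
    rwa [add_div, mul_div_assoc]
  have h5 : NR A R + 2 * A < 2 * A * 2 ^ R := by exact_mod_cast h4
  have h6 : 2 * A * 2 ^ R = 2 * (2 ^ R * A) := by ring
  omega

/-- The translates `φ_{R,k}` with `0 ≤ k ≤ 2^R A - A` are supported in `[0, A]`. -/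
theorem dilTrans_ae_eq_zero_of_le {φ : L2R} {a : ℝ} {A : ℕ} (haA : a ≤ A)
    (hφ : ∀ᵐ x, x ∉ Set.Icc 0 a → φ x = 0) {R k : ℕ} (hk : k + A ≤ 2 ^ R * A) :
    ∀ᵐ x : ℝ, x ∉ Set.Icc 0 (A : ℝ) → dilTrans φ R k x = 0 := by
  filter_upwards [dilTrans_ae_eq_zero hφ R k] with x hx hxA
  refine hx fun h => hxA ?_
  have hp : (0 : ℝ) < 2 ^ R := by positivity
  have hk' : (k : ℝ) + A ≤ 2 ^ R * A := by exact_mod_cast hk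
  have hk0 : (0 : ℝ) ≤ k := k.cast_nonneg
  obtain ⟨h1, h2⟩ := h
  rw [zpow_natCast, Int.cast_natCast] at h1 h2
  constructor
  · by_contra hneg
    nlinarith
  · refine le_of_mul_le_mul_left ?_ hp
    linarith

theorem exists_real_between_samplingRatio {Θ : ℕ → ℕ} {r : ℝ} (hr : 0 < r)
    (h : samplingRatio Θ < ENNReal.ofReal (1 / r)) :
    ∃ q : ℝ, 0 < q ∧ q * r < 1 ∧ ∀ᶠ N : ℕ in atTop, (Θ N : ℝ) ≤ q * N := by
  obtain ⟨p, hp1, hp2⟩ := exists_between h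
  have hp : p ≠ ⊤ := hp2.ne_top
  refine ⟨p.toReal, ENNReal.toReal_pos (bot_le.trans_lt hp1).ne' hp, ?_, ?_⟩
  · rwa [← lt_div_iff₀ hr, ← ENNReal.lt_ofReal_iff_toReal_lt hp]
  · filter_upwards [eventually_lt_of_limsup_lt hp1, eventually_ge_atTop 1] with N hN hN1
    have hN0 : (N : ℝ≥0∞) ≠ 0 := by
      rw [Nat.cast_ne_zero]
      omega
    have h1 : (Θ N : ℝ≥0∞) ≤ p * N :=
      (ENNReal.div_le_iff hN0 (ENNReal.natCast_ne_top N)).1 hN.le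
    have h2 := ENNReal.toReal_mono (ENNReal.mul_ne_top hp (ENNReal.natCast_ne_top N)) h1
    rwa [ENNReal.toReal_natCast, ENNReal.toReal_mul, ENNReal.toReal_natCast] at h2

theorem eventually_sq_mul_pow_le {σ : ℝ} (hσ0 : 0 < σ) (hσ1 : σ < 1) (C q : ℝ) :
    ∀ᶠ m : ℕ in atTop, (m + 1 : ℝ) * (2 * q * m + 1) * C * σ ^ m ≤ 1 := by
  have ha : |σ| < 1 := by rwa [abs_of_pos hσ0]
  have h2 := tendsto_pow_const_mul_const_pow_of_abs_lt_one 2 ha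
  have h1 := tendsto_pow_const_mul_const_pow_of_abs_lt_one 1 ha
  have h0 := tendsto_pow_const_mul_const_pow_of_abs_lt_one 0 ha
  have h := ((h2.const_mul (2 * q)).add ((h1.const_mul (2 * q + 1)).add h0)).const_mul C
  have hlt : C * (2 * q * 0 + ((2 * q + 1) * 0 + 0)) < 1 := by norm_num
  filter_upwards [h.eventually_lt_const hlt] with m hm
  refine le_trans (le_of_eq ?_) hm.le
  ring

/-! ### Exponential growth of the condition number -/

theorem exists_eventually_exp_le_condNumber {a : ℝ} (ha : 1 ≤ a) {φ ψ : L2R}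
    (hwav : IsMRAWavelet φ ψ) (hφ : essSupport φ = Set.Icc 0 a)
    (hψ : essSupport ψ = Set.Icc 0 a) {T₁ T₂ ε : ℝ} (hT₁ : (⌈a⌉₊ : ℝ) - 1 ≤ T₁)
    (hT₂ : 2 * (⌈a⌉₊ : ℝ) - 1 ≤ T₂) (hε : 0 < ε) (hεT : ε ≤ 1 / (T₁ + T₂))
    {Θ : ℕ → ℕ} {G : ℕ → L2R → L2R}
    (hG : ∀ N : ℕ, 1 ≤ N →
      IsPerfectMethod (samples T₁ T₂ ε (Θ N)) (reconSpace a φ ψ N) (G N))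
    (hη : samplingRatio Θ < ENNReal.ofReal (1 / (ε * ⌈a⌉₊))) :
    ∃ c : ℝ, 0 < c ∧ ∀ᶠ R : ℕ in atTop,
      ENNReal.ofReal (Real.exp (c * NR ⌈a⌉₊ R)) ≤
        condNumber (samples T₁ T₂ ε (Θ (NR ⌈a⌉₊ R))) (G (NR ⌈a⌉₊ R)) := by
  obtain ⟨V, hV, hW⟩ := hwav
  have hφ0 := ae_eq_zero_of_essSupport_subset hφ.subset
  have hψ0 := ae_eq_zero_of_essSupport_subset hψ.subset
  have hA : 1 ≤ ⌈a⌉₊ := Nat.one_le_ceil_iff.2 (by linarith)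
  have haA : a ≤ ⌈a⌉₊ := Nat.le_ceil a
  have hA' : (1 : ℝ) ≤ ⌈a⌉₊ := by exact_mod_cast hA
  have hTpos : 0 < T₁ + T₂ := by linarith
  have hεT' : ε * (T₁ + T₂) ≤ 1 := (le_div_iff₀ hTpos).1 hεT
  have hεTpos : 0 < ε * (T₁ + T₂) := mul_pos hε hTpos
  have hsub : Set.Icc 0 (⌈a⌉₊ : ℝ) ⊆
      Set.Icc (-T₁ / (ε * (T₁ + T₂))) (T₂ / (ε * (T₁ + T₂))) := by
    refine Set.Icc_subset_Icc (div_nonpos_of_nonpos_of_nonneg (by linarith) hεTpos.le) ?_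
    rw [le_div_iff₀ hεTpos]
    nlinarith
  obtain ⟨q, hq0, hq1, hΘ⟩ :=
    exists_real_between_samplingRatio (r := ε * ⌈a⌉₊) (by positivity) hη
  -- Sampled indices satisfy |l| ≤ qN_R/2, and N_R/2^R → A; thus |lε/2^R| is eventually below any β
  -- > qεA/2.
  obtain ⟨β, hβ1, hβ2⟩ : ∃ β, q * ε / 2 * ⌈a⌉₊ < β ∧ β < 1 / 2 := exists_between (by linarith)
  have hβ0 : 0 < β := lt_of_le_of_lt (by positivity) hβ1
  set σ := Real.sin (Real.pi * β) with hσ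
  have hpi := Real.pi_pos
  have hσ0 : 0 < σ := Real.sin_pos_of_pos_of_lt_pi (by positivity) (by nlinarith)
  have hσ1 : σ < 1 := by
    rw [← Real.sin_pi_div_two]
    exact Real.sin_lt_sin_of_lt_of_le_pi_div_two (by nlinarith) le_rfl (by nlinarith)
  set D := ‖samplingVec T₁ T₂ ε 0‖
  -- The squared quotient gains σ^{-2m}: half of the exponent is spent on polynomial factors, and N
  -- ≤ 2m turns the remaining σ^{-m} into at least σ^{-N/2}, the square of exp(cN).
  refine ⟨-Real.log σ / 4, by linarith [Real.log_neg hσ0 hσ1], ?_⟩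
  have hNR := tendsto_NR_atTop hA
  have hm : Tendsto (fun R : ℕ => 2 ^ R * ⌈a⌉₊ - ⌈a⌉₊) atTop atTop := by
    refine tendsto_atTop.2 fun b => ?_
    filter_upwards [eventually_NR_le hA, hNR.eventually_ge_atTop (2 * b)] with R h1 h2
    omega
  filter_upwards [eventually_NR_le hA, hNR.eventually hΘ, hNR.eventually_ge_atTop 1,
    hm.eventually (eventually_sq_mul_pow_le hσ0 hσ1 (D ^ 2) q),
    ((tendsto_NR_div ⌈a⌉₊).const_mul (q * ε / 2)).eventually_lt_const hβ1]
    with R hNm hΘN hN1 hsmall hfreq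
  set N := NR ⌈a⌉₊ R
  set m := 2 ^ R * ⌈a⌉₊ - ⌈a⌉₊ with hmdef
  have hp : (0 : ℝ) < 2 ^ R := by positivity
  have hmA : m + ⌈a⌉₊ = 2 ^ R * ⌈a⌉₊ :=
    Nat.sub_add_cancel (Nat.le_mul_of_pos_left _ (by positivity))
  have hsupp : ∀ k : ℕ, k ≤ m → ∀ᵐ x : ℝ, x ∉ Set.Icc 0 (⌈a⌉₊ : ℝ) → dilTrans φ R k x = 0 :=
    fun k hk => dilTrans_ae_eq_zero_of_le haA hφ0 (by omega)
  set f := binomialComb φ R m with hf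
  have hfnorm : (4 : ℝ) ^ m ≤ (m + 1) * ‖f‖ ^ 2 := norm_binomialComb_sq hV.basis.1 R m
  have hfT : f ∈ reconSpace a φ ψ N := by
    refine Submodule.sum_mem _ fun k hk => Submodule.smul_mem _ _ ?_
    exact mem_reconSpace ha hV hW hφ0 hψ0 R (hV.dilTrans_mem R k)
      (hsupp k (Nat.lt_succ_iff.1 (Finset.mem_range.1 hk)))
  have hf0 : f ≠ 0 := by
    intro h
    rw [h, norm_zero] at hfnorm
    have : (0 : ℝ) < 4 ^ m := by positivity
    linarith
  obtain ⟨hs0, hcond⟩ := condNumber_ge (isLinearMap_samples T₁ T₂ ε (Θ N)) (hG N hN1) hfT hf0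
  refine le_trans (ENNReal.ofReal_le_ofReal ?_) hcond
  have hsf : ‖samples T₁ T₂ ε (Θ N) f‖ ^ 2 ≤ (Θ N + 1) * ((2 * σ) ^ m * D) ^ 2 := by
    refine norm_samples_le fun l hl => ?_
    refine norm_inner_samplingVec_binomialComb_le hV.basis.1
      (fun k hk => (hsupp k hk).mono fun x hx hxI => hx fun h => hxI (hsub h)) ?_ hβ2.le
    rw [abs_div, abs_mul, abs_of_pos hε, abs_of_pos hp, div_le_iff₀ hp]
    have h1 := abs_le_of_mem_sampleIndex hl
    have h2 : q * ε / 2 * N < β * 2 ^ R := by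
      rwa [← mul_div_assoc, div_lt_iff₀ hp] at hfreq
    nlinarith
  rw [le_div_iff₀ hs0]
  refine (pow_le_pow_iff_left₀ (by positivity) (norm_nonneg f) two_ne_zero).1 ?_
  rw [mul_pow]
  have hexp : Real.exp (-Real.log σ / 4 * N) ^ 2 * σ ^ m ≤ 1 := by
    rw [← Real.exp_nat_mul, ← Real.exp_log (pow_pos hσ0 m), ← Real.exp_add, Real.exp_le_one_iff,
      Real.log_pow]
    have hNm' : (N : ℝ) ≤ 2 * m := by exact_mod_cast hNm
    have := Real.log_neg hσ0 hσ1
    push_cast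
    nlinarith
  have hΘm : (Θ N : ℝ) + 1 ≤ 2 * q * m + 1 := by
    have hNm' : (N : ℝ) ≤ 2 * m := by exact_mod_cast hNm
    nlinarith
  have hm1 : (0 : ℝ) < m + 1 := by positivity
  set E := Real.exp (-Real.log σ / 4 * N) ^ 2
  refine le_of_mul_le_mul_left (le_trans ?_ hfnorm) hm1
  calc (m + 1 : ℝ) * (E * ‖samples T₁ T₂ ε (Θ N) f‖ ^ 2)
      ≤ (m + 1) * (E * ((2 * q * m + 1) * ((2 * σ) ^ m * D) ^ 2)) := by
        have := hsf.trans (mul_le_mul_of_nonneg_right hΘm (sq_nonneg _))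
        gcongr
    -- One factor σ^m pays for `E`, the other for the polynomial.
    _ = ((E * σ ^ m) * ((m + 1) * (2 * q * m + 1) * D ^ 2 * σ ^ m)) * 4 ^ m := by
        have h4 : (4 : ℝ) ^ m = (2 ^ m) ^ 2 := by rw [← pow_mul, mul_comm, pow_mul]; norm_num
        rw [h4, mul_pow 2 σ m]
        ring
    _ ≤ 1 * 4 ^ m := by
        refine mul_le_mul_of_nonneg_right (mul_le_one₀ hexp (by positivity) hsmall) (by positivity)
    _ = 4 ^ m := one_mul _

end WaveletSampling

theorem theorem4p3
    -- the compactly supported MRA wavelet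
    (a : ℝ) (ha : 1 ≤ a) (φ ψ : WaveletSampling.L2R)
    (hwav : WaveletSampling.IsMRAWavelet φ ψ)
    (hφ : WaveletSampling.essSupport φ = Set.Icc 0 a)
    (hψ : WaveletSampling.essSupport ψ = Set.Icc 0 a)
    -- the Fourier sampling scheme
    (T₁ T₂ ε : ℝ) (hT₁ : (⌈a⌉₊ : ℝ) - 1 ≤ T₁) (hT₂ : 2 * (⌈a⌉₊ : ℝ) - 1 ≤ T₂)
    (hε : 0 < ε) (hεT : ε ≤ 1 / (T₁ + T₂))
    -- the sequence of perfect methods `G N`, using `Θ N` samples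
    (Θ : ℕ → ℕ) (G : ℕ → WaveletSampling.L2R → WaveletSampling.L2R)
    (hG : ∀ N : ℕ, 1 ≤ N → WaveletSampling.IsPerfectMethod
      (WaveletSampling.samples T₁ T₂ ε (Θ N)) (WaveletSampling.reconSpace a φ ψ N) (G N))
    (hη₁ : 1 ≤ WaveletSampling.samplingRatio Θ)
    (hη : WaveletSampling.samplingRatio Θ < ENNReal.ofReal (1 / (ε * ⌈a⌉₊))) :
    (∀ K : ℝ≥0, ∃ᶠ N : ℕ in atTop,
      (K : ℝ≥0∞) < WaveletSampling.condNumber (WaveletSampling.samples T₁ T₂ ε (Θ N)) (G N)) ∧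
    (∃ c : ℝ, 0 < c ∧ ∀ᶠ R : ℕ in atTop,
      ENNReal.ofReal (Real.exp (c * WaveletSampling.NR ⌈a⌉₊ R)) ≤
        WaveletSampling.condNumber
          (WaveletSampling.samples T₁ T₂ ε (Θ (WaveletSampling.NR ⌈a⌉₊ R)))
          (G (WaveletSampling.NR ⌈a⌉₊ R))) := by
  have hexp := WaveletSampling.exists_eventually_exp_le_condNumber ha hwav hφ hψ hT₁ hT₂ hε hεT
    hG hη
  refine ⟨fun K => ?_, hexp⟩
  obtain ⟨c, hc, hR⟩ := hexp
  have hNR := WaveletSampling.tendsto_NR_atTop (Nat.one_le_ceil_iff.2 (by linarith : 0 < a))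
  -- Unboundedness need only be seen along the subsequence N_R.
  refine hNR.frequently (Eventually.frequently ?_)
  have hlim : Tendsto (fun R : ℕ => Real.exp (c * WaveletSampling.NR ⌈a⌉₊ R)) atTop atTop :=
    Real.tendsto_exp_atTop.comp
      ((tendsto_natCast_atTop_atTop.comp hNR).const_mul_atTop hc)
  filter_upwards [hR, hlim.eventually_gt_atTop (K : ℝ)] with R h1 h2
  refine lt_of_lt_of_le ?_ h1
  rwa [← ENNReal.ofReal_coe_nnreal, ENNReal.ofReal_lt_ofReal_iff (Real.exp_pos _)]
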